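/- Notation. Points of phase space are $z=(x,v)\in\mathbb R^3\times\mathbb R^3=\mathbb R^6$, and $B_r(0)\subset\mathbb R^6$ is the Euclidean ball. For $f=f(t,x,v)$ put $\rho_f(t,x)=\int f(t,x,v)\,dv$ and $\psi_f(t,x)=\int \frac{\rho_f(t,y)}{|x-y|}\,dy$, and for $f,g$ put $$\Phi_{f,g}(t,x)=-\iint \frac{x-y}{|x-y|^3}\cdot\partial_v f(t,y,w)\,g(t,y,w)\,dw\,dy .$$ Let $\mathring f,f_d\in C^2_c(\mathbb R^6)$. For $T>0$, $\lambda\in(0,1]$ and $\chi\in C^2(\mathbb R^6;[0,1])$ (for instance $\chi\equiv 1$, or a compactly supported cut-off function that equals $1$ on a large ball) consider the optimality system $$\begin{cases} \partial_t f+v\cdot\partial_x f-\partial_x\psi_f\cdot\partial_v f+(v\times B)\cdot\partial_v f=0, & f|_{t=0}=\mathring f,\\ \partial_t g+v\cdot\partial_x g-\partial_x\psi_f\cdot\partial_v g+(v\times B)\cdot\partial_v g=\Phi_{f,g}\,\chi, & g|_{t=T}=f(T)-f_d,\\ B(t,x)=-\dfrac1{4\pi\lambda}\displaystyle\iint\frac1{|x-y|}\,\big(w\times\partial_v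 f(t,y,w)\big)\,g(t,y,w)\,d(y,w) \end{cases}$$ on $[0,T]$. A classical solution with support radius $r>0$ is a triple $(f,g,B)$ satisfying this system pointwise, with $f,g\in C^1([0,T]\times\mathbb R^6)$, $B\in C([0,T];C^1_b(\mathbb R^3;\mathbb R^3))$ and $\operatorname{supp} f(t),\operatorname{supp} g(t)\subset B_r(0)$ for all $t\in[0,T]$. Theorem. A classical solution of the optimality system is unique if $T/\lambda$ is sufficiently small. More precisely: for all $\mathring f,f_d\in C^2_c(\mathbb R^6)$, $r>0$ and $M\in\mathbb R$ there is $\varepsilon>0$, depending only on $\mathring f,f_d,r,M$, such that the following holds for all $T>0$ and $\lambda\in(0,1]$ with $T/\lambda<\varepsilon$ and all $\chi\in C^2(\mathbb R^6;[0,1])$. If $(f,g,B)$ and $(\tilde f,\tilde g,\tilde B)$ are two classical solutions with support radius $r$ and, for each $h\in\{f,g,\tilde f,\tilde g\}$, the functions $|h|$, $|\partial_x h|$, $|\partial_v h|$ are bounded by $M$ on $[0,T]\times\mathbb R^6$, then $f=\tilde f$ and $g=\tilde g$ on $[0,T]\times\mathbb R^6$ and $B=\tilde B$ on $[0,T]\times\mathbb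 R^3$. -/

import Mathlib

open MeasureTheory Set

noncomputable section

namespace VlasovPoisson

/-- Three-dimensional Euclidean space. -/
abbrev E3 : Type := EuclideanSpace ℝ (Fin 3)

/-- Cross product on `E3`. -/
def cross (a b : E3) : E3 := WithLp.toLp 2 (crossProduct a.ofLp b.ofLp)

/-- `∂ₜ f (t, x, v)` on the closed interval `[0, T]` (one-sided at the end points). -/
def dt (T : ℝ) (f : ℝ → E3 → E3 → ℝ) (t : ℝ) (x v : E3) : ℝ :=
  derivWithin (fun s => f s x v) (Icc 0 T) t

/-- `∂ₓ f (t, x, v)`. -/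
def dx (f : ℝ → E3 → E3 → ℝ) (t : ℝ) (x v : E3) : E3 :=
  gradient (fun y => f t y v) x

/-- `∂ᵥ f (t, x, v)`. -/
def dv (f : ℝ → E3 → E3 → ℝ) (t : ℝ) (x v : E3) : E3 :=
  gradient (fun w => f t x w) v

/-- The spatial density `ρ_f (t, x) = ∫ f (t, x, v) dv`. -/
def rho (f : ℝ → E3 → E3 → ℝ) (t : ℝ) (x : E3) : ℝ :=
  ∫ v : E3, f t x v

/-- The potential `ψ_f (t, x) = ∫ ρ_f (t, y) / |x - y| dy`. -/
def psi (f : ℝ → E3 → E3 → ℝ) (t : ℝ) (x : E3) : ℝ :=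
  ∫ y : E3, rho f t y / ‖x - y‖

/-- `Φ_{a,f} (t, x) = - ∬ (x - y) / |x - y|³ · ∂ᵥ a (t, y, w) f (t, y, w) dw dy`. -/
def Phi (a f : ℝ → E3 → E3 → ℝ) (t : ℝ) (x : E3) : ℝ :=
  - ∫ p : E3 × E3, inner ℝ ((1 / ‖x - p.1‖ ^ 3) • (x - p.1)) (dv a t p.1 p.2) * f t p.1 p.2

/-- `∂ₜ h + v · ∂ₓ h - ∂ₓ ψ_f · ∂ᵥ h + (v × B) · ∂ᵥ h`. -/
def vlasovOp (T : ℝ) (f : ℝ → E3 → E3 → ℝ) (B : ℝ → E3 → E3)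
    (h : ℝ → E3 → E3 → ℝ) (t : ℝ) (x v : E3) : ℝ :=
  dt T h t x v + inner ℝ v (dx h t x v) - inner ℝ (gradient (psi f t) x) (dv h t x v)
    + inner ℝ (cross v (B t x)) (dv h t x v)

/-- `h ∈ C¹([0, T] × ℝ⁶)`. -/
def IsC1 (T : ℝ) (h : ℝ → E3 → E3 → ℝ) : Prop :=
  ContDiffOn ℝ 1 (fun p : ℝ × E3 × E3 => h p.1 p.2.1 p.2.2) (Icc 0 T ×ˢ univ)

/-- `supp h(t) ⊆ B_r(0)` (Euclidean ball of `ℝ⁶`) for all `t ∈ [0, T]`. -/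
def SuppInBall (T r : ℝ) (h : ℝ → E3 → E3 → ℝ) : Prop :=
  ∀ t ∈ Icc 0 T, tsupport (fun z : E3 × E3 => h t z.1 z.2) ⊆
    {z | Real.sqrt (‖z.1‖ ^ 2 + ‖z.2‖ ^ 2) < r}

/-- The `C([0, T]; C¹_b(ℝ⁶))` size of `h` is at most `M`. -/
def C1BoundedBy (T M : ℝ) (h : ℝ → E3 → E3 → ℝ) : Prop :=
  ∀ t ∈ Icc 0 T, ∀ x v : E3, |h t x v| ≤ M ∧ ‖dx h t x v‖ ≤ M ∧ ‖dv h t x v‖ ≤ M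

/-- `B ∈ C([0, T]; C¹_b(ℝ³; ℝ³))`. -/
structure IsContC1b (T : ℝ) (B : ℝ → E3 → E3) : Prop where
  contDiff : ∀ t ∈ Icc 0 T, ContDiff ℝ 1 (B t)
  bounded : ∀ t ∈ Icc 0 T, ∃ b : ℝ, ∀ x, ‖B t x‖ ≤ b ∧ ‖fderiv ℝ (B t) x‖ ≤ b
  continuous : ∀ t ∈ Icc 0 T, ∀ ε > 0, ∃ δ > 0, ∀ s ∈ Icc 0 T, |s - t| < δ →
    ∀ x, ‖B s x - B t x‖ ≤ ε ∧ ‖fderiv ℝ (B s) x - fderiv ℝ (B t) x‖ ≤ ε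

/-- `(f, g, B)` is a classical solution on `[0, T]`, with `f(t)` and `g(t)` supported in `B_r(0)`,
of the optimality system with parameter `lam`, initial datum `f₀`, target `fd` and weight `χ` in
front of `Φ_{f,g}`. The weight `χ = 1` gives the system without a cut-off. -/
structure IsClassicalSolution (T lam : ℝ) (f₀ fd χ : E3 → E3 → ℝ) (r : ℝ)
    (f g : ℝ → E3 → E3 → ℝ) (B : ℝ → E3 → E3) : Prop where
  f_C1 : IsC1 T f
  g_C1 : IsC1 T g
  B_C1b : IsContC1b T B
  f_supp : SuppInBall T r f
  g_supp : SuppInBall T r g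
  f_eq : ∀ t ∈ Icc 0 T, ∀ x v, vlasovOp T f B f t x v = 0
  f_init : ∀ x v, f 0 x v = f₀ x v
  g_eq : ∀ t ∈ Icc 0 T, ∀ x v, vlasovOp T f B g t x v = Phi f g t x * χ x v
  g_final : ∀ x v, g T x v = f T x v - fd x v
  B_eq : ∀ t ∈ Icc 0 T, ∀ x, B t x = (-(1 / (4 * Real.pi * lam))) •
    ∫ p : E3 × E3, (1 / ‖x - p.1‖) • (g t p.1 p.2 • cross p.2 (dv f t p.1 p.2))

/-- `h ∈ C²_c(ℝ⁶)`. -/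
def IsC2c (h : E3 → E3 → ℝ) : Prop :=
  ContDiff ℝ 2 (fun z : E3 × E3 => h z.1 z.2) ∧
    HasCompactSupport (fun z : E3 × E3 => h z.1 z.2)

/-- `χ ∈ C²(ℝ⁶; [0, 1])`. -/
def IsC2Weight (χ : E3 → E3 → ℝ) : Prop :=
  ContDiff ℝ 2 (fun z : E3 × E3 => χ z.1 z.2) ∧ ∀ x v, χ x v ∈ Icc (0 : ℝ) 1

end VlasovPoisson

end

noncomputable section

namespace VlasovPoisson

/-! The map from two solutions to their difference contracts in the sup norm of `f - f'` and `g -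
g'`, although the source `Φ` and the field `B` contain velocity derivatives. No derivative is lost
because `g ∂ᵥf - g' ∂ᵥf' = (g - g') ∂ᵥf - (f - f') ∂ᵥg' + ∂ᵥ(g' (f - f'))`, and the last term
integrates to zero: the Coulomb force does not depend on the velocity `w`, and `w ×` pairs each
`w_j` only with derivatives in other directions. Hence the differences of the force `∂ₓψ`, of `Φ`
and of `λB` are at most a constant times the sup-norm difference `α` (`norm_gradient_psi_sub_le`,
`IsGradientKernel.norm_integral_sub_le`).

A maximum principle (`le_add_of_abs_dt_le`) replaces characteristics. Where the phase-space gradient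
of `h - h'` vanishes, the transport terms cancel up to the differences of the fields acting on
`∂ᵥh'`, so `h - h'` grows by at most `T` times a multiple of `α / λ`. Applied to `f` from time `0`
and then to `g` backwards from time `T`, this halves `α` when `T / λ` is small (`abs_sub_le_half`);
iteration gives `α = 0`, and `B` is determined by `f` and `g`. -/

/-! ### Singular kernels and their integrals over balls -/

/-- The truncated inverse square `1_{|z| < 1} |z|⁻² + 2`, which majorizes `1 + |z|⁻²`. -/
def majorant (z : E3) : ℝ := (Metric.ball (0 : E3) 1).indicator (fun z => 1 / ‖z‖ ^ 2) z + 2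

lemma majorant_nonneg (z : E3) : 0 ≤ majorant z := by
  unfold majorant
  have := indicator_nonneg (s := Metric.ball (0 : E3) 1) (f := fun z : E3 => 1 / ‖z‖ ^ 2)
    (fun z _ => by positivity) z
  linarith

lemma one_add_inv_sq_le_majorant (z : E3) : 1 + 1 / ‖z‖ ^ 2 ≤ majorant z := by
  unfold majorant
  by_cases hz : z ∈ Metric.ball (0 : E3) 1
  · rw [indicator_of_mem hz]; linarith
  · rw [indicator_of_notMem hz]
    have h1 : 1 ≤ ‖z‖ := by simpa using hz
    have : 1 / ‖z‖ ^ 2 ≤ 1 := by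
      rw [div_le_one (by positivity)]
      exact one_le_pow₀ h1
    linarith

lemma inv_norm_le_majorant (z : E3) : 1 / ‖z‖ ≤ majorant z := by
  refine le_trans ?_ (one_add_inv_sq_le_majorant z)
  have : 1 / ‖z‖ ^ 2 = (1 / ‖z‖) ^ 2 := by rw [div_pow, one_pow]
  rw [this]
  nlinarith [sq_nonneg (1 / ‖z‖ - 1), sq_nonneg (1 / ‖z‖)]

lemma norm_coulombForce_le_majorant (z : E3) : ‖(1 / ‖z‖ ^ 3) • z‖ ≤ majorant z := by
  refine le_trans ?_ (one_add_inv_sq_le_majorant z)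
  rcases eq_or_ne z 0 with rfl | hz
  · simp
  · have : 0 < ‖z‖ := norm_pos_iff.mpr hz
    rw [norm_smul, Real.norm_of_nonneg (by positivity)]
    have : 1 / ‖z‖ ^ 3 * ‖z‖ = 1 / ‖z‖ ^ 2 := by field_simp
    linarith

/-- The product `|a|⁻¹ |b|⁻¹` is split by the arithmetic-geometric mean inequality. This makes the
Newtonian potential Lipschitz without differentiating under the singular integral. -/
lemma abs_inv_norm_sub_inv_norm_le {a b : E3} (ha : a ≠ 0) (hb : b ≠ 0) :
    |1 / ‖a‖ - 1 / ‖b‖| ≤ ‖a - b‖ * (majorant a + majorant b) := by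
  have ha' : 0 < ‖a‖ := norm_pos_iff.mpr ha
  have hb' : 0 < ‖b‖ := norm_pos_iff.mpr hb
  have h1 : 1 / ‖a‖ - 1 / ‖b‖ = (‖b‖ - ‖a‖) * (1 / ‖a‖ * (1 / ‖b‖)) := by field_simp
  have h2 : |‖b‖ - ‖a‖| ≤ ‖a - b‖ := by
    rw [abs_sub_comm]; exact abs_norm_sub_norm_le a b
  have h3 : 1 / ‖a‖ * (1 / ‖b‖) ≤ majorant a + majorant b := by
    have := one_add_inv_sq_le_majorant a
    have := one_add_inv_sq_le_majorant b
    have e : ∀ z : E3, 1 / ‖z‖ ^ 2 = (1 / ‖z‖) ^ 2 := fun z => by rw [div_pow, one_pow]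
    rw [e] at *
    nlinarith [sq_nonneg (1 / ‖a‖ - 1 / ‖b‖), sq_nonneg (1 / ‖a‖), sq_nonneg (1 / ‖b‖)]
  rw [h1, abs_mul, abs_of_nonneg (a := 1 / ‖a‖ * (1 / ‖b‖)) (by positivity)]
  exact mul_le_mul h2 h3 (by positivity) (norm_nonneg _)

/-- In polar coordinates the Jacobian `s²` cancels the singularity. -/
lemma integrable_indicator_inv_sq :
    Integrable ((Metric.ball (0 : E3) 1).indicator (fun z => 1 / ‖z‖ ^ 2)) := by
  rw [integrable_indicator_iff Metric.isOpen_ball.measurableSet,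
    integrableOn_fun_norm_addHaar volume (f := fun s : ℝ => 1 / s ^ 2)]
  have : IntegrableOn (fun _ : ℝ => (1 : ℝ)) (Ioo 0 1) := by simp
  refine this.congr_fun (fun s hs => ?_) measurableSet_Ioo
  have : s ≠ 0 := hs.1.ne'
  simp [this]

lemma integrableOn_majorant (x : E3) (r : ℝ) :
    IntegrableOn (fun y => majorant (x - y)) (Metric.closedBall 0 r) := by
  unfold majorant
  refine IntegrableOn.add ?_ ?_
  · exact (integrable_indicator_inv_sq.comp_sub_left x).integrableOn
  · exact integrableOn_const (measure_closedBall_lt_top.ne)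

/-- A bound for the integral of `majorant (x - ·)` over `closedBall 0 r`, uniform in `x`. -/
def majorantConst (r : ℝ) : ℝ :=
  (∫ z, (Metric.ball (0 : E3) 1).indicator (fun z => 1 / ‖z‖ ^ 2) z)
    + volume.real (Metric.closedBall (0 : E3) r) * 2

lemma setIntegral_majorant_le (x : E3) (r : ℝ) :
    ∫ y in Metric.closedBall 0 r, majorant (x - y) ≤ majorantConst r := by
  have hi := integrable_indicator_inv_sq.comp_sub_left x
  unfold majorant majorantConst
  rw [integral_add hi.integrableOn (integrableOn_const (measure_closedBall_lt_top.ne))]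
  refine add_le_add ?_ ?_
  · rw [← integral_sub_left_eq_self _ volume x]
    refine setIntegral_le_integral hi (.of_forall fun y => ?_)
    exact indicator_nonneg (fun z _ => by positivity) _
  · simp

/-- The integrand is dominated by a product function on a product of balls. The bound is only asked
almost everywhere, since the estimate for `1 / |x - y|` fails to apply at the singular points. -/
lemma integrable_and_norm_integral_le {V : Type*} [NormedAddCommGroup V] [NormedSpace ℝ V]
    {r C : ℝ} {k : E3 → ℝ} (hk : IntegrableOn k (Metric.closedBall 0 r))
    {Q : E3 × E3 → V} (hQ : AEStronglyMeasurable Q) (h0 : ∀ p, r < ‖p‖ → Q p = 0)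
    (hb : ∀ᵐ p, ‖Q p‖ ≤ C * k p.1) :
    Integrable Q ∧ ‖∫ p, Q p‖ ≤
      C * ((∫ y in Metric.closedBall 0 r, k y) * volume.real (Metric.closedBall (0 : E3) r)) := by
  set b := Metric.closedBall (0 : E3) r
  have hbm : MeasurableSet b := Metric.isClosed_closedBall.measurableSet
  have h1 : Integrable (b.indicator k) := (integrable_indicator_iff hbm).2 hk
  have h2 : Integrable (b.indicator (fun _ => (1 : ℝ))) :=
    (integrable_indicator_iff hbm).2 (integrableOn_const (measure_closedBall_lt_top.ne))
  have h12 : Integrable (fun p : E3 × E3 => C * (b.indicator k p.1 * b.indicator 1 p.2)) :=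
    (h1.mul_prod h2).const_mul C
  have hdom : ∀ᵐ p, ‖Q p‖ ≤ C * (b.indicator k p.1 * b.indicator 1 p.2) := by
    filter_upwards [hb] with p hp
    by_cases h : p.1 ∈ b ∧ p.2 ∈ b
    · simpa [h.1, h.2] using hp
    · have : r < ‖p‖ := by
        by_contra! hc
        refine h ⟨?_, ?_⟩
        · simpa [b] using (norm_fst_le p).trans hc
        · simpa [b] using (norm_snd_le p).trans hc
      rw [h0 p this, norm_zero]
      rcases not_and_or.1 h with h | h <;> simp [h]
  refine ⟨h12.mono' hQ hdom, (norm_integral_le_of_norm_le h12 hdom).trans (le_of_eq ?_)⟩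
  rw [integral_const_mul]
  congr 1
  have := integral_prod_mul (μ := (volume : Measure E3)) (ν := (volume : Measure E3))
    (b.indicator k) (b.indicator 1)
  rw [Measure.volume_eq_prod, this, integral_indicator hbm, integral_indicator hbm]
  simp

/-- A bound for the integral of `majorant (x - y)` over `(y, w)` in the product of two balls. -/
def kernelConst (r : ℝ) : ℝ := majorantConst r * volume.real (Metric.closedBall (0 : E3) r)

lemma kernelConst_nonneg (r : ℝ) : 0 ≤ kernelConst r := by
  have h : (0 : ℝ) ≤ ∫ y in Metric.closedBall (0 : E3) r, majorant (0 - y) :=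
    integral_nonneg fun _ => majorant_nonneg _
  exact mul_nonneg (h.trans (setIntegral_majorant_le 0 r)) measureReal_nonneg

lemma integrable_and_norm_integral_le_kernelConst
    {V : Type*} [NormedAddCommGroup V] [NormedSpace ℝ V]
    {r C : ℝ} (hC : 0 ≤ C) (x : E3) {Q : E3 × E3 → V} (hQ : AEStronglyMeasurable Q)
    (h0 : ∀ p, r < ‖p‖ → Q p = 0) (hb : ∀ p, ‖Q p‖ ≤ C * majorant (x - p.1)) :
    Integrable Q ∧ ‖∫ p, Q p‖ ≤ C * kernelConst r := by
  obtain ⟨h1, h2⟩ := integrable_and_norm_integral_le (integrableOn_majorant x r) hQ h0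
    (.of_forall hb)
  refine ⟨h1, h2.trans (mul_le_mul_of_nonneg_left ?_ hC)⟩
  exact mul_le_mul_of_nonneg_right (setIntegral_majorant_le x r) measureReal_nonneg

/-! ### Gradients, cross products and integration by parts in velocity -/

lemma inner_gradient_eq_fderiv (φ : E3 → ℝ) (w c : E3) :
    inner ℝ c (gradient φ w) = fderiv ℝ φ w c := by
  rw [real_inner_comm, gradient, InnerProductSpace.toDual_symm_apply]

lemma gradient_ofLp (φ : E3 → ℝ) (w : E3) (k : Fin 3) :
    (gradient φ w).ofLp k = fderiv ℝ φ w (EuclideanSpace.single k 1) := by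
  rw [← inner_gradient_eq_fderiv, EuclideanSpace.inner_single_left, map_one, one_mul]

lemma gradient_sub {φ ψ : E3 → ℝ} {w : E3} (hφ : DifferentiableAt ℝ φ w)
    (hψ : DifferentiableAt ℝ ψ w) :
    gradient (fun z => φ z - ψ z) w = gradient φ w - gradient ψ w := by
  simp only [gradient]
  rw [fderiv_fun_sub hφ hψ, map_sub]

lemma gradient_mul {φ ψ : E3 → ℝ} {w : E3} (hφ : DifferentiableAt ℝ φ w)
    (hψ : DifferentiableAt ℝ ψ w) :
    gradient (fun z => φ z * ψ z) w = φ w • gradient ψ w + ψ w • gradient φ w := by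
  simp only [gradient]
  rw [fderiv_fun_mul hφ hψ, map_add]
  simp

lemma continuous_gradient {φ : E3 → ℝ} (hφ : ContDiff ℝ 1 φ) : Continuous (gradient φ) := by
  unfold gradient
  exact (InnerProductSpace.toDual ℝ E3).symm.continuous.comp (hφ.continuous_fderiv (by norm_num))

/-- Integration by parts moves the derivative onto `a`, which is constant in the direction `c`. -/
lemma integral_fderiv_apply_eq_zero {φ : E3 → ℝ} (hφ : ContDiff ℝ 1 φ) (hc : HasCompactSupport φ)
    {a : E3 → ℝ} (ha : ContDiff ℝ 1 a) {c : E3} (hac : ∀ w, fderiv ℝ a w c = 0) :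
    ∫ w, a w * fderiv ℝ φ w c = 0 := by
  have hcφ : Continuous fun w => fderiv ℝ φ w c := (hφ.continuous_fderiv (by norm_num)).clm_apply continuous_const
  rw [integral_mul_fderiv_eq_neg_fderiv_mul_of_integrable]
  · simp [hac]
  · simp [hac]
  · refine (ha.continuous.mul hcφ).integrable_of_hasCompactSupport ?_
    exact (hc.fderiv_apply ℝ c).mul_left
  · exact (ha.continuous.mul hφ.continuous).integrable_of_hasCompactSupport hc.mul_left
  · exact fun w _ => ha.differentiable (by norm_num) w
  · exact fun w _ => hφ.differentiable (by norm_num) w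

lemma integral_inner_gradient_eq_zero {φ : E3 → ℝ} (hφ : ContDiff ℝ 1 φ)
    (hc : HasCompactSupport φ) (c : E3) : ∫ w, inner ℝ c (gradient φ w) = 0 := by
  simp_rw [inner_gradient_eq_fderiv]
  simpa using integral_fderiv_apply_eq_zero hφ hc (a := fun _ => 1) contDiff_const (c := c)
    (by simp)

lemma cross_apply_zero (a b : E3) : (cross a b) 0 = a 1 * b 2 - a 2 * b 1 := by
  simp [cross, cross_apply]

lemma cross_apply_one (a b : E3) : (cross a b) 1 = a 2 * b 0 - a 0 * b 2 := by
  simp [cross, cross_apply]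

lemma cross_apply_two (a b : E3) : (cross a b) 2 = a 0 * b 1 - a 1 * b 0 := by
  simp [cross, cross_apply]

lemma isLinearMap_cross (a : E3) : IsLinearMap ℝ (cross a) where
  map_add b c := by simp [cross]
  map_smul s b := by simp [cross]

lemma norm_cross_le (a b : E3) : ‖cross a b‖ ≤ ‖a‖ * ‖b‖ := by
  refine abs_le_of_sq_le_sq' ?_ (by positivity) |>.2
  rw [mul_pow, EuclideanSpace.norm_sq_eq, EuclideanSpace.norm_sq_eq, EuclideanSpace.norm_sq_eq]
  simp only [Fin.sum_univ_three, Real.norm_eq_abs, sq_abs, cross_apply_zero, cross_apply_one,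
    cross_apply_two]
  nlinarith [sq_nonneg (a 0 * b 0 + a 1 * b 1 + a 2 * b 2)]

lemma continuous_cross : Continuous fun p : E3 × E3 => cross p.1 p.2 := by
  unfold cross
  refine (PiLp.continuous_toLp 2 _).comp (continuous_pi fun i => ?_)
  fin_cases i <;> simp [cross_apply] <;> fun_prop

/-- Each component is a difference of terms `w_j ∂_k φ` with `j ≠ k`, and `w_j` is constant in
direction `k`. -/
lemma integral_cross_gradient_eq_zero {φ : E3 → ℝ} (hφ : ContDiff ℝ 1 φ)
    (hc : HasCompactSupport φ) : ∫ w, cross w (gradient φ w) = 0 := by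
  have hi : Integrable fun w => cross w (gradient φ w) := by
    refine (continuous_cross.comp
      (continuous_id.prodMk (continuous_gradient hφ))).integrable_of_hasCompactSupport ?_
    refine (hc.fderiv ℝ).mono fun w hw hw' => hw ?_
    simp [gradient, hw', (isLinearMap_cross w).map_zero]
  have key : ∀ j k : Fin 3, j ≠ k → Integrable (fun w : E3 => w j * (gradient φ w) k) ∧
      ∫ w : E3, w j * (gradient φ w) k = 0 := by
    intro j k hjk
    simp_rw [gradient_ofLp]
    have ha : ContDiff ℝ 1 fun w : E3 => w j := by fun_prop
    constructor
    · refine (ha.continuous.mul ((hφ.continuous_fderiv (by norm_num)).clm_apply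
        continuous_const)).integrable_of_hasCompactSupport ?_
      exact (hc.fderiv_apply ℝ _).mul_left
    · refine integral_fderiv_apply_eq_zero hφ hc ha fun w => ?_
      have : HasFDerivAt (fun w : E3 => w j) (EuclideanSpace.proj (𝕜 := ℝ) j) w :=
        (EuclideanSpace.proj (𝕜 := ℝ) j).hasFDerivAt
      rw [this.fderiv]
      simp [hjk]
  have key2 : ∀ j k : Fin 3, j ≠ k →
      ∫ w : E3, (w j * (gradient φ w) k - w k * (gradient φ w) j) = 0 := fun j k h => by
    rw [integral_sub (key j k h).1 (key k j h.symm).1, (key j k h).2, (key k j h.symm).2, sub_zero]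
  ext i
  have := (EuclideanSpace.proj (𝕜 := ℝ) i).integral_comp_comm hi
  rw [show (∫ w, cross w (gradient φ w)) i = ∫ w, (cross w (gradient φ w)) i from this.symm]
  fin_cases i
  · simpa [cross_apply_zero] using key2 1 2 (by decide)
  · simpa [cross_apply_one] using key2 2 0 (by decide)
  · simpa [cross_apply_two] using key2 0 1 (by decide)

/-! ### Compactly supported functions on phase space -/

/-- `h` is a `C¹` function on phase space that vanishes outside the closed ball of radius `r`
(in the product norm). -/
structure IsC1Supported (r : ℝ) (h : E3 → E3 → ℝ) : Prop where
  contDiff : ContDiff ℝ 1 fun z : E3 × E3 => h z.1 z.2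
  eq_zero : ∀ z : E3 × E3, r < ‖z‖ → h z.1 z.2 = 0

/-- The velocity gradient of a function on phase space. -/
def gradv (h : E3 → E3 → ℝ) (x v : E3) : E3 := gradient (fun w => h x w) v

namespace IsC1Supported

variable {r : ℝ} {h k : E3 → E3 → ℝ}

lemma contDiff_right (hh : IsC1Supported r h) (x : E3) : ContDiff ℝ 1 (h x) :=
  hh.contDiff.comp (contDiff_const.prodMk contDiff_id : ContDiff ℝ 1 fun w : E3 => (x, w))

lemma contDiff_left (hh : IsC1Supported r h) (v : E3) : ContDiff ℝ 1 (fun x => h x v) :=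
  hh.contDiff.comp (contDiff_id.prodMk contDiff_const : ContDiff ℝ 1 fun w : E3 => (w, v))

lemma differentiableAt_right (hh : IsC1Supported r h) (x v : E3) :
    DifferentiableAt ℝ (fun w => h x w) v :=
  (hh.contDiff_right x).differentiable (by norm_num) v

lemma differentiableAt_left (hh : IsC1Supported r h) (x v : E3) :
    DifferentiableAt ℝ (fun y => h y v) x :=
  (hh.contDiff_left v).differentiable (by norm_num) x

lemma hasCompactSupport_right (hh : IsC1Supported r h) (x : E3) : HasCompactSupport (h x) := by
  refine HasCompactSupport.intro (isCompact_closedBall (0 : E3) r) fun w hw => ?_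
  refine hh.eq_zero (x, w) (lt_of_lt_of_le ?_ (norm_snd_le (x, w)))
  simpa using hw

lemma hasCompactSupport (hh : IsC1Supported r h) :
    HasCompactSupport fun z : E3 × E3 => h z.1 z.2 := by
  refine HasCompactSupport.intro (isCompact_closedBall (0 : E3 × E3) r) fun w hw => ?_
  exact hh.eq_zero w (by simpa using hw)

lemma sub (hh : IsC1Supported r h) (hk : IsC1Supported r k) :
    IsC1Supported r fun x v => h x v - k x v :=
  ⟨hh.contDiff.sub hk.contDiff, fun z hz => by rw [hh.eq_zero z hz, hk.eq_zero z hz, sub_zero]⟩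

lemma mul (hh : IsC1Supported r h) (hk : IsC1Supported r k) :
    IsC1Supported r fun x v => h x v * k x v :=
  ⟨hh.contDiff.mul hk.contDiff, fun z hz => by rw [hh.eq_zero z hz, zero_mul]⟩

lemma gradv_eq_zero (hh : IsC1Supported r h) {z : E3 × E3} (hz : r < ‖z‖) :
    gradv h z.1 z.2 = 0 := by
  have : (fun w => h z.1 w) =ᶠ[nhds z.2] fun _ => 0 := by
    have hc : Continuous fun w : E3 => ‖((z.1, w) : E3 × E3)‖ := by fun_prop
    filter_upwards [(hc.isOpen_preimage _ isOpen_Ioi).mem_nhds (show z.2 ∈ _ from hz)] with w hw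
    exact hh.eq_zero (z.1, w) hw
  rw [gradv, gradient, this.fderiv_eq]
  simp

lemma continuous_gradv (hh : IsC1Supported r h) : Continuous fun z : E3 × E3 => gradv h z.1 z.2 := by
  unfold gradv gradient
  refine (InnerProductSpace.toDual ℝ E3).symm.continuous.comp ?_
  have : ∀ z : E3 × E3, fderiv ℝ (fun w => h z.1 w) z.2 =
      (fderiv ℝ (fun z : E3 × E3 => h z.1 z.2) z).comp (ContinuousLinearMap.inr ℝ E3 E3) := by
    intro z
    have h1 : HasFDerivAt (fun w : E3 => ((z.1, w) : E3 × E3))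
        (ContinuousLinearMap.inr ℝ E3 E3) z.2 := hasFDerivAt_prodMk_right z.1 z.2
    have h2 := (hh.contDiff.differentiable (by norm_num) z).hasFDerivAt
    exact (HasFDerivAt.comp (f := fun w : E3 => ((z.1, w) : E3 × E3)) z.2 h2 h1).fderiv
  simp_rw [this]
  exact (hh.contDiff.continuous_fderiv (by norm_num)).clm_comp continuous_const

lemma gradv_sub (hh : IsC1Supported r h) (hk : IsC1Supported r k) (x v : E3) :
    gradv (fun x v => h x v - k x v) x v = gradv h x v - gradv k x v :=
  gradient_sub (hh.differentiableAt_right x v) (hk.differentiableAt_right x v)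

lemma gradv_mul (hh : IsC1Supported r h) (hk : IsC1Supported r k) (x v : E3) :
    gradv (fun x v => h x v * k x v) x v = h x v • gradv k x v + k x v • gradv h x v :=
  gradient_mul (hh.differentiableAt_right x v) (hk.differentiableAt_right x v)

end IsC1Supported

/-! ### Integrals of velocity gradients without loss of derivatives -/

section Kernel

variable {V : Type*} [NormedAddCommGroup V] [NormedSpace ℝ V]

/-- A family of linear maps on velocity gradients, dominated by the majorant of the Coulomb force at
`x`, that annihilates velocity gradients of compactly supported functions after integration. -/
structure IsGradientKernel (r c : ℝ) (x : E3) (L : E3 × E3 → E3 → V) : Prop where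
  nonneg : 0 ≤ c
  isLinearMap : ∀ p, IsLinearMap ℝ (L p)
  aestronglyMeasurable : ∀ u : E3 × E3 → E3, Continuous u →
    AEStronglyMeasurable fun p => L p (u p)
  norm_le : ∀ p, ‖p‖ ≤ r → ∀ u, ‖L p u‖ ≤ c * majorant (x - p.1) * ‖u‖
  integral_gradv : ∀ h, IsC1Supported r h → ∀ y, ∫ w, L (y, w) (gradv h y w) = 0

namespace IsGradientKernel

variable {r c α M : ℝ} {x : E3} {L : E3 × E3 → E3 → V}

lemma integrable_and_norm_integral_le (hL : IsGradientKernel r c x L) {u : E3 × E3 → E3}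
    (hu : Continuous u) (h0 : ∀ p, r < ‖p‖ → u p = 0) {A : ℝ} (hA : ∀ p, ‖u p‖ ≤ A) :
    Integrable (fun p => L p (u p)) ∧ ‖∫ p, L p (u p)‖ ≤ c * A * kernelConst r := by
  have hA0 : 0 ≤ A := (norm_nonneg _).trans (hA 0)
  have hz : ∀ p, r < ‖p‖ → L p (u p) = 0 := fun p hp => by
    rw [h0 p hp, (hL.isLinearMap p).map_zero]
  refine integrable_and_norm_integral_le_kernelConst (mul_nonneg hL.nonneg hA0) x
    (hL.aestronglyMeasurable u hu) hz fun p => ?_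
  rcases lt_or_ge r ‖p‖ with hp | hp
  · rw [hz p hp, norm_zero]
    exact mul_nonneg (mul_nonneg hL.nonneg hA0) (majorant_nonneg _)
  · refine (hL.norm_le p hp _).trans ?_
    rw [mul_right_comm]
    exact mul_le_mul_of_nonneg_right (mul_le_mul_of_nonneg_left (hA p) hL.nonneg)
      (majorant_nonneg _)

lemma integrable (hL : IsGradientKernel r c x L) {u : E3 × E3 → E3}
    (hu : Continuous u) (h0 : ∀ p, r < ‖p‖ → u p = 0) : Integrable (fun p => L p (u p)) := by
  have hc : HasCompactSupport u :=
    HasCompactSupport.intro (isCompact_closedBall (0 : E3 × E3) r) fun w hw => h0 w (by simpa using hw)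
  obtain ⟨A, hA⟩ := hc.exists_bound_of_continuous hu
  exact (hL.integrable_and_norm_integral_le hu h0 hA).1

lemma norm_integral_sub_le_of_decomposition (hL : IsGradientKernel r c x L)
    {a b u₁ u₂ u₃ : E3 × E3 → E3} {A : ℝ} (ha : Continuous a) (ha0 : ∀ p, r < ‖p‖ → a p = 0)
    (hb : Continuous b) (hb0 : ∀ p, r < ‖p‖ → b p = 0)
    (h₁ : Continuous u₁) (h₁0 : ∀ p, r < ‖p‖ → u₁ p = 0) (hA₁ : ∀ p, ‖u₁ p‖ ≤ A)
    (h₂ : Continuous u₂) (h₂0 : ∀ p, r < ‖p‖ → u₂ p = 0) (hA₂ : ∀ p, ‖u₂ p‖ ≤ A)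
    (h₃ : Continuous u₃) (h₃0 : ∀ p, r < ‖p‖ → u₃ p = 0) (hi : ∫ p, L p (u₃ p) = 0)
    (hd : ∀ p, a p - b p = u₁ p - u₂ p + u₃ p) :
    ‖(∫ p, L p (a p)) - ∫ p, L p (b p)‖ ≤ 2 * (c * A * kernelConst r) := by
  obtain ⟨i1, e1⟩ := hL.integrable_and_norm_integral_le h₁ h₁0 hA₁
  obtain ⟨i2, e2⟩ := hL.integrable_and_norm_integral_le h₂ h₂0 hA₂
  have i3 := hL.integrable h₃ h₃0
  have key : ∀ p, L p (a p) - L p (b p) = L p (u₁ p) - L p (u₂ p) + L p (u₃ p) := fun p => by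
    rw [← (hL.isLinearMap p).map_sub, ← (hL.isLinearMap p).map_sub, ← (hL.isLinearMap p).map_add,
      hd]
  rw [← integral_sub (hL.integrable ha ha0) (hL.integrable hb hb0), integral_congr_ae (.of_forall key),
    integral_add (f := fun p => L p (u₁ p) - L p (u₂ p)) (i1.sub i2) i3, integral_sub i1 i2, hi, add_zero, two_mul]
  exact (norm_sub_le _ _).trans (add_le_add e1 e2)

/-- By the product rule, `g ∂ᵥf - g' ∂ᵥf'` is a combination of undifferentiated differences plus the
pure velocity gradient of `g' (f - f')`, which the kernel annihilates after Fubini. Gradient bounds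
are thus needed only for `f` and `g'`. -/
lemma norm_integral_sub_le (hL : IsGradientKernel r c x L) {f g f' g' : E3 → E3 → ℝ}
    (hf : IsC1Supported r f) (hg : IsC1Supported r g) (hf' : IsC1Supported r f')
    (hg' : IsC1Supported r g') (hα : 0 ≤ α) (hfα : ∀ x v, |f x v - f' x v| ≤ α)
    (hgα : ∀ x v, |g x v - g' x v| ≤ α) (hfM : ∀ x v, ‖gradv f x v‖ ≤ M)
    (hgM : ∀ x v, ‖gradv g' x v‖ ≤ M) :
    ‖(∫ p : E3 × E3, L p (g p.1 p.2 • gradv f p.1 p.2)) -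
      ∫ p : E3 × E3, L p (g' p.1 p.2 • gradv f' p.1 p.2)‖ ≤ 2 * c * M * α * kernelConst r := by
  have hF := hf.sub hf'
  have hG := hg.sub hg'
  have hgF := hg'.mul hF
  have int : ∀ {a b : E3 → E3 → ℝ}, IsC1Supported r a → IsC1Supported r b →
      Continuous (fun p : E3 × E3 => a p.1 p.2 • gradv b p.1 p.2) ∧
      ∀ p : E3 × E3, r < ‖p‖ → a p.1 p.2 • gradv b p.1 p.2 = 0 := fun ha hb =>
    ⟨ha.contDiff.continuous.smul hb.continuous_gradv,
      fun p hp => by rw [hb.gradv_eq_zero hp, smul_zero]⟩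
  have bd : ∀ {a b : E3 → E3 → ℝ}, (∀ x v, |a x v| ≤ α) → (∀ x v, ‖gradv b x v‖ ≤ M) →
      ∀ p : E3 × E3, ‖a p.1 p.2 • gradv b p.1 p.2‖ ≤ α * M := fun ha hb p => by
    rw [norm_smul]
    exact mul_le_mul (ha _ _) (hb _ _) (norm_nonneg _) hα
  have i3 := hL.integrable hgF.continuous_gradv fun p hp => hgF.gradv_eq_zero hp
  have e3 : ∫ p : E3 × E3, L p (gradv (fun x v => g' x v * (f x v - f' x v)) p.1 p.2) = 0 := by
    rw [Measure.volume_eq_prod] at i3 ⊢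
    rw [integral_prod _ i3, integral_congr_ae (.of_forall fun y => hL.integral_gradv _ hgF y)]
    exact integral_zero _ _
  have hd : ∀ p : E3 × E3, g p.1 p.2 • gradv f p.1 p.2 - g' p.1 p.2 • gradv f' p.1 p.2 =
      (g p.1 p.2 - g' p.1 p.2) • gradv f p.1 p.2 - (f p.1 p.2 - f' p.1 p.2) • gradv g' p.1 p.2 +
      gradv (fun x v => g' x v * (f x v - f' x v)) p.1 p.2 := fun p => by
    rw [hg'.gradv_mul hF, hf.gradv_sub hf']
    module
  have b1 := bd (a := fun x v => g x v - g' x v) (b := f) hgα hfM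
  have b2 := bd (a := fun x v => f x v - f' x v) (b := g') hfα hgM
  obtain ⟨c1, z1⟩ := int hG hf
  obtain ⟨c2, z2⟩ := int hF hg'
  obtain ⟨ca, za⟩ := int hg hf
  obtain ⟨cb, zb⟩ := int hg' hf'
  have h := hL.norm_integral_sub_le_of_decomposition ca za cb zb c1 z1 b1 c2 z2 b2
    hgF.continuous_gradv (fun p hp => hgF.gradv_eq_zero hp) e3 hd
  exact h.trans (le_of_eq (by ring))

end IsGradientKernel

end Kernel

lemma isGradientKernel_coulombForce (r : ℝ) (x : E3) :
    IsGradientKernel r 1 x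
      fun p u => inner ℝ ((1 / ‖x - p.1‖ ^ 3) • (x - p.1)) u where
  nonneg := zero_le_one
  isLinearMap p := ⟨fun a b => inner_add_right _ _ _, fun s a => inner_smul_right _ _ _⟩
  aestronglyMeasurable u hu := by
    have := hu.measurable
    exact Measurable.aestronglyMeasurable (by fun_prop)
  norm_le p _ u := by
    refine (norm_inner_le_norm _ _).trans ?_
    rw [one_mul]
    exact mul_le_mul_of_nonneg_right (norm_coulombForce_le_majorant _) (norm_nonneg _)
  integral_gradv h hh y :=
    integral_inner_gradient_eq_zero (hh.contDiff_right y) (hh.hasCompactSupport_right y)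
      ((1 / ‖x - y‖ ^ 3) • (x - y))

/-- The constant `r` bounds the factor `|w|` on the support. -/
lemma isGradientKernel_biotSavart {r : ℝ} (hr : 0 ≤ r) (x : E3) :
    IsGradientKernel r r x fun p u => (1 / ‖x - p.1‖) • cross p.2 u where
  nonneg := hr
  isLinearMap p := by
    refine ⟨fun a b => ?_, fun s a => ?_⟩
    · rw [(isLinearMap_cross p.2).map_add, smul_add]
    · rw [(isLinearMap_cross p.2).map_smul, smul_comm]
  aestronglyMeasurable u hu := by
    have := (continuous_cross.comp (continuous_snd.prodMk hu)).measurable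
    have h1 : Measurable fun p : E3 × E3 => 1 / ‖x - p.1‖ := by fun_prop
    exact (h1.smul this).aestronglyMeasurable
  norm_le p hp u := by
    rw [norm_smul, Real.norm_of_nonneg (by positivity)]
    have h1 := norm_cross_le p.2 u
    have h2 : ‖p.2‖ ≤ r := (norm_snd_le p).trans hp
    calc 1 / ‖x - p.1‖ * ‖cross p.2 u‖ ≤ majorant (x - p.1) * (r * ‖u‖) := by
          refine mul_le_mul (inv_norm_le_majorant _) (h1.trans ?_) (norm_nonneg _)
            (majorant_nonneg _)
          exact mul_le_mul_of_nonneg_right h2 (norm_nonneg _)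
      _ = r * majorant (x - p.1) * ‖u‖ := by ring
  integral_gradv h hh y := by
    have := integral_cross_gradient_eq_zero (hh.contDiff_right y) (hh.hasCompactSupport_right y)
    change ∫ w, (1 / ‖x - y‖) • cross w (gradient (h y) w) = 0
    rw [integral_smul, this, smul_zero]

/-! ### Estimates of the fields at a fixed time -/

section Slice

variable {r α M t : ℝ} {f g f' g' : ℝ → E3 → E3 → ℝ}

lemma abs_Phi_sub_le (hf : IsC1Supported r (f t)) (hg : IsC1Supported r (g t))
    (hf' : IsC1Supported r (f' t)) (hg' : IsC1Supported r (g' t)) (hα : 0 ≤ α)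
    (hfα : ∀ x v, |f t x v - f' t x v| ≤ α) (hgα : ∀ x v, |g t x v - g' t x v| ≤ α)
    (hfM : ∀ x v, ‖dv f t x v‖ ≤ M) (hgM : ∀ x v, ‖dv g' t x v‖ ≤ M) (x : E3) :
    |Phi f g t x - Phi f' g' t x| ≤ 2 * M * α * kernelConst r := by
  have h := (isGradientKernel_coulombForce r x).norm_integral_sub_le hf hg hf' hg' hα hfα hgα
    hfM hgM
  simp_rw [inner_smul_right] at h
  have e : ∀ f g : ℝ → E3 → E3 → ℝ, Phi f g t x = - ∫ p : E3 × E3, g t p.1 p.2 *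
      inner ℝ ((1 / ‖x - p.1‖ ^ 3) • (x - p.1)) (gradv (f t) p.1 p.2) := fun f g => by
    unfold Phi dv gradv
    simp_rw [mul_comm]
  rw [e, e, neg_sub_neg, abs_sub_comm]
  rw [mul_one] at h
  exact h

lemma norm_integral_biotSavart_sub_le (hr : 0 ≤ r) (hf : IsC1Supported r (f t))
    (hg : IsC1Supported r (g t))
    (hf' : IsC1Supported r (f' t)) (hg' : IsC1Supported r (g' t)) (hα : 0 ≤ α)
    (hfα : ∀ x v, |f t x v - f' t x v| ≤ α) (hgα : ∀ x v, |g t x v - g' t x v| ≤ α)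
    (hfM : ∀ x v, ‖dv f t x v‖ ≤ M) (hgM : ∀ x v, ‖dv g' t x v‖ ≤ M) (x : E3) :
    ‖(∫ p : E3 × E3, (1 / ‖x - p.1‖) • (g t p.1 p.2 • cross p.2 (dv f t p.1 p.2))) -
      ∫ p : E3 × E3, (1 / ‖x - p.1‖) • (g' t p.1 p.2 • cross p.2 (dv f' t p.1 p.2))‖
      ≤ 2 * r * M * α * kernelConst r := by
  have h := (isGradientKernel_biotSavart hr x).norm_integral_sub_le hf hg hf' hg' hα hfα hgα
    hfM hgM
  simp_rw [(isLinearMap_cross _).map_smul] at h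
  exact h

lemma integrable_potential {h : E3 → E3 → ℝ} (hh : IsC1Supported r h) (x : E3) :
    Integrable fun p : E3 × E3 => h p.1 p.2 / ‖x - p.1‖ := by
  obtain ⟨A, hA⟩ := hh.hasCompactSupport.exists_bound_of_continuous hh.contDiff.continuous
  have hA0 : 0 ≤ A := (norm_nonneg _).trans (hA 0)
  have hm := hh.contDiff.continuous.measurable
  refine (integrable_and_norm_integral_le_kernelConst (r := r) hA0 x
    (Measurable.aestronglyMeasurable (by fun_prop))
    (fun p hp => by rw [hh.eq_zero p hp, zero_div]) fun p => ?_).1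
  rw [div_eq_mul_one_div, norm_mul, Real.norm_of_nonneg (r := 1 / ‖x - p.1‖) (by positivity)]
  exact mul_le_mul (hA p) (inv_norm_le_majorant _) (by positivity) hA0

lemma psi_eq_integral_prod (hf : IsC1Supported r (f t)) (x : E3) :
    psi f t x = ∫ p : E3 × E3, f t p.1 p.2 / ‖x - p.1‖ := by
  have h := integrable_potential hf x
  rw [Measure.volume_eq_prod] at h ⊢
  rw [integral_prod _ h]
  simp_rw [integral_div]
  rfl

lemma locallyIntegrable_inv_norm_fst :
    LocallyIntegrable fun p : E3 × E3 => 1 / ‖p.1‖ := by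
  rw [locallyIntegrable_iff]
  intro K hK
  obtain ⟨R, hR⟩ := hK.isBounded.subset_closedBall 0
  refine IntegrableOn.mono_set ?_ hR
  have hms : MeasurableSet (Metric.closedBall (0 : E3 × E3) R) :=
    Metric.isClosed_closedBall.measurableSet
  rw [← integrable_indicator_iff hms]
  refine (integrable_and_norm_integral_le_kernelConst (r := R) zero_le_one 0
    (Measurable.aestronglyMeasurable (Measurable.indicator (by fun_prop) hms))
    (fun p hp => indicator_of_notMem (by simpa using hp) _) fun p => ?_).1
  rw [one_mul]
  refine (norm_indicator_le_norm_self _ _).trans ?_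
  rw [Real.norm_of_nonneg (by positivity)]
  simpa using inv_norm_le_majorant (0 - p.1)

/-- On `ℝ⁶` the potential is the convolution of the `C¹` function `f t` of compact support with the
locally integrable `1 / |p.1|`, evaluated at `(x, 0)`. Differentiability is needed to write a
difference of gradients as the gradient of a difference. -/
lemma differentiableAt_psi (hf : IsC1Supported r (f t)) (x : E3) :
    DifferentiableAt ℝ (psi f t) x := by
  have : (volume : Measure (E3 × E3)).IsAddHaarMeasure := by
    rw [Measure.volume_eq_prod]; infer_instance
  have : (volume : Measure (E3 × E3)).IsNegInvariant :=
    Measure.IsAddHaarMeasure.isNegInvariant_of_regular _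
  have h := hf.hasCompactSupport.contDiff_convolution_left (ContinuousLinearMap.mul ℝ ℝ)
    hf.contDiff locallyIntegrable_inv_norm_fst (μ := volume)
  have e : psi f t = fun x => (convolution (fun z : E3 × E3 => f t z.1 z.2)
      (fun p : E3 × E3 => 1 / ‖p.1‖) (ContinuousLinearMap.mul ℝ ℝ) volume) (x, 0) := by
    funext x
    rw [psi_eq_integral_prod hf, convolution_def]
    simp [div_eq_mul_inv]
  rw [e]
  exact (h.comp (contDiff_id.prodMk contDiff_const : ContDiff ℝ 1 fun w : E3 => (w, (0 : E3)))
    ).differentiable (by norm_num) x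

lemma ae_fst_ne (x : E3) : ∀ᵐ p : E3 × E3, p.1 ≠ x := by
  rw [Measure.volume_eq_prod]
  exact Measure.quasiMeasurePreserving_fst.ae (measure_eq_zero_iff_ae_notMem.1 (measure_singleton x))

lemma norm_gradient_psi_sub_le (hf : IsC1Supported r (f t)) (hf' : IsC1Supported r (f' t))
    (hα : 0 ≤ α) (hfα : ∀ x v, |f t x v - f' t x v| ≤ α) (x : E3) :
    ‖gradient (psi f t) x - gradient (psi f' t) x‖ ≤ 2 * α * kernelConst r := by
  have hF := hf.sub hf'
  have hm := hF.contDiff.continuous.measurable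
  rw [← gradient_sub (differentiableAt_psi hf x) (differentiableAt_psi hf' x), gradient,
    LinearIsometryEquiv.norm_map]
  have e : ∀ x, psi f t x - psi f' t x =
      ∫ p : E3 × E3, (f t p.1 p.2 - f' t p.1 p.2) / ‖x - p.1‖ := fun x => by
    rw [psi_eq_integral_prod hf, psi_eq_integral_prod hf',
      ← integral_sub (integrable_potential hf x) (integrable_potential hf' x)]
    simp_rw [sub_div]
  have hK := kernelConst_nonneg r
  -- A Lipschitz constant bounds the derivative; the factor 2 comes from one majorant centred at `x`
  -- and one at `y`.
  refine norm_fderiv_le_of_lip' ℝ (by positivity) (.of_forall fun y => ?_)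
  rw [e, e, ← integral_sub (integrable_potential hF y) (integrable_potential hF x)]
  have hk : IntegrableOn (fun z => majorant (y - z) + majorant (x - z)) (Metric.closedBall 0 r) :=
    (integrableOn_majorant y r).add (integrableOn_majorant x r)
  refine (integrable_and_norm_integral_le (C := α * ‖y - x‖) hk
    (Measurable.aestronglyMeasurable (by fun_prop)) (fun p hp => ?_) ?_).2.trans ?_
  · rw [hF.eq_zero p hp]; simp
  · filter_upwards [ae_fst_ne x, ae_fst_ne y] with p hx hy
    have h1 := abs_inv_norm_sub_inv_norm_le (sub_ne_zero.2 hy.symm) (sub_ne_zero.2 hx.symm)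
    rw [sub_sub_sub_cancel_right] at h1
    rw [div_eq_mul_one_div, div_eq_mul_one_div (f t p.1 p.2 - f' t p.1 p.2) ‖x - p.1‖, ← mul_sub,
      norm_mul, mul_assoc]
    exact mul_le_mul (hfα _ _) h1 (norm_nonneg _) hα
  · rw [integral_add (integrableOn_majorant y r) (integrableOn_majorant x r)]
    have h1 := setIntegral_majorant_le y r
    have h2 := setIntegral_majorant_le x r
    have h3 : ((∫ z in Metric.closedBall 0 r, majorant (y - z)) +
        ∫ z in Metric.closedBall 0 r, majorant (x - z)) * volume.real (Metric.closedBall (0 : E3) r)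
        ≤ 2 * kernelConst r := by
      rw [kernelConst, ← mul_assoc]
      exact mul_le_mul_of_nonneg_right (by linarith) measureReal_nonneg
    calc _ ≤ α * ‖y - x‖ * (2 * kernelConst r) := mul_le_mul_of_nonneg_left h3 (by positivity)
      _ = _ := by ring

end Slice

/-! ### Time regularity and the maximum principle -/

lemma IsC1.isC1Supported {T r t : ℝ} {h : ℝ → E3 → E3 → ℝ} (hh : IsC1 T h)
    (hs : SuppInBall T r h) (ht : t ∈ Icc 0 T) : IsC1Supported r (h t) where
  contDiff := by
    rw [← contDiffOn_univ]
    exact ContDiffOn.comp (f := fun z : E3 × E3 => (t, z.1, z.2)) hh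
      (contDiff_const.prodMk (contDiff_fst.prodMk contDiff_snd)).contDiffOn
      fun z _ => ⟨ht, mem_univ _⟩
  eq_zero z hz := by
    by_contra hne
    have h1 := hs t ht (subset_tsupport _ (show z ∈ Function.support _ from hne))
    have h2 : ‖z‖ ≤ Real.sqrt (‖z.1‖ ^ 2 + ‖z.2‖ ^ 2) := by
      refine max_le ?_ ?_
      · exact Real.le_sqrt_of_sq_le (by nlinarith [sq_nonneg ‖z.2‖])
      · exact Real.le_sqrt_of_sq_le (by nlinarith [sq_nonneg ‖z.1‖])
    have h3 : Real.sqrt (‖z.1‖ ^ 2 + ‖z.2‖ ^ 2) < r := h1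
    linarith

lemma IsC1.hasDerivWithinAt {T t : ℝ} {h : ℝ → E3 → E3 → ℝ} (hh : IsC1 T h)
    (ht : t ∈ Icc 0 T) (x v : E3) :
    HasDerivWithinAt (fun s => h s x v) (dt T h t x v) (Icc 0 T) t := by
  have h1 : ContDiffOn ℝ 1 (fun s => h s x v) (Icc 0 T) :=
    ContDiffOn.comp (f := fun s : ℝ => (s, x, v)) hh
      (contDiff_id.prodMk contDiff_const).contDiffOn fun s hs => ⟨hs, mem_univ _⟩
  exact (h1.differentiableOn (by norm_num) t ht).hasDerivWithinAt

/-- The derivative of `u` at a maximum `t` of `s ↦ u s - c |s - t₀|` over `[0, T]` is at least `c`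
in absolute value, unless `t = t₀`. -/
lemma le_abs_of_isMaxOn_sub_mul_abs {T t t₀ c d : ℝ} {u : ℝ → ℝ} (ht : t ∈ Icc 0 T)
    (ht₀ : t₀ ∈ Icc 0 T) (hne : t ≠ t₀) (hu : HasDerivWithinAt u d (Icc 0 T) t)
    (hmax : ∀ s ∈ Icc 0 T, u s - c * |s - t₀| ≤ u t - c * |t - t₀|) : c ≤ |d| := by
  by_contra! hlt
  -- Moving from `t` a fraction `η` of the way to `t₀` lowers the penalty by `c η |t - t₀|`. With
  -- this tolerance `u` drops by at most `(c + |d|) / 2 · η |t - t₀|`, which is less, contradicting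
  -- maximality.
  have ho := hu.isLittleO.def (show 0 < (c - |d|) / 2 by linarith)
  have hpos : 0 < |t - t₀| := abs_pos.2 (sub_ne_zero.2 hne)
  have htend : Filter.Tendsto (fun η : ℝ => t + η * (t₀ - t)) (nhdsWithin 0 (Ioo 0 1))
      (nhdsWithin t (Icc 0 T)) := by
    refine tendsto_nhdsWithin_iff.2 ⟨?_, ?_⟩
    · have : Continuous fun η : ℝ => t + η * (t₀ - t) := by fun_prop
      simpa using (this.tendsto 0).mono_left nhdsWithin_le_nhds
    · filter_upwards [self_mem_nhdsWithin] with η hη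
      have h1 := hη.1; have h2 := hη.2
      constructor <;> nlinarith [ht.1, ht.2, ht₀.1, ht₀.2]
  have : (nhdsWithin (0 : ℝ) (Ioo 0 1)).NeBot := left_nhdsWithin_Ioo_neBot one_pos
  obtain ⟨η, ⟨hη, hs⟩, hη0, hη1⟩ :=
    ((htend.eventually (ho.and self_mem_nhdsWithin)).and self_mem_nhdsWithin).exists
  have hm := hmax _ hs
  have e1 : t + η * (t₀ - t) - t₀ = (1 - η) * (t - t₀) := by ring
  have e2 : t + η * (t₀ - t) - t = -(η * (t - t₀)) := by ring
  rw [e1, abs_mul, abs_of_pos (show 0 < 1 - η by linarith)] at hm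
  rw [e2, norm_neg, Real.norm_eq_abs, Real.norm_eq_abs, abs_mul, abs_of_pos hη0, smul_eq_mul] at hη
  have h3 := (abs_le.1 hη).1
  have h4 : η * (t - t₀) * d ≤ η * |t - t₀| * |d| := by
    refine (le_abs_self _).trans (le_of_eq ?_)
    rw [abs_mul, abs_mul, abs_of_pos hη0]
  have h5 : 0 < η * |t - t₀| := mul_pos hη0 hpos
  nlinarith

/-- A maximum principle: only the points where the spatial gradient vanishes matter. -/
lemma le_add_of_abs_dt_le {T r S m t₀ : ℝ} {H : ℝ → E3 → E3 → ℝ} (hT : 0 < T)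
    (ht₀ : t₀ ∈ Icc 0 T) (hH : IsC1 T H) (hs : ∀ t ∈ Icc 0 T, IsC1Supported r (H t))
    (hS : 0 ≤ S) (hm : 0 ≤ m) (h0 : ∀ x v, H t₀ x v ≤ m)
    (hcrit : ∀ t ∈ Icc 0 T, ∀ x v, dx H t x v = 0 → dv H t x v = 0 → |dt T H t x v| ≤ S) :
    ∀ t ∈ Icc 0 T, ∀ x v, H t x v ≤ m + S * T := by
  intro t₂ ht₂ x₂ v₂
  by_contra! hlt
  -- Half of the excess is spent on making the penalty slope `S + δ` strictly larger than `S`; the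
  -- other half keeps the penalized maximum above `m`.
  set δ := (H t₂ x₂ v₂ - (m + S * T)) / (2 * T) with hδ
  have hδ0 : 0 < δ := div_pos (by linarith) (by linarith)
  have hδT : δ * T = (H t₂ x₂ v₂ - (m + S * T)) / 2 := by rw [hδ]; field_simp
  have hdist : |t₂ - t₀| ≤ T := abs_le.2 ⟨by linarith [ht₂.1, ht₀.2], by linarith [ht₂.2, ht₀.1]⟩
  have hST : 0 ≤ S * T := mul_nonneg hS hT.le
  have hz₂ : ((x₂, v₂) : E3 × E3) ∈ Metric.closedBall (0 : E3 × E3) r := by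
    by_contra hc
    have := (hs t₂ ht₂).eq_zero (x₂, v₂) (not_le.1 fun h => hc (mem_closedBall_zero_iff.2 h))
    simp only at this
    linarith
  have hcont : ContinuousOn (fun p : ℝ × E3 × E3 => H p.1 p.2.1 p.2.2 - (S + δ) * |p.1 - t₀|)
      (Icc 0 T ×ˢ Metric.closedBall (0 : E3 × E3) r) := by
    refine ContinuousOn.sub (hH.continuousOn.mono (prod_mono_right (subset_univ _))) ?_
    fun_prop
  obtain ⟨⟨t₁, x₁, v₁⟩, ⟨ht₁, -⟩, hmax⟩ := (isCompact_Icc.prod (isCompact_closedBall (0 : E3 × E3)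
    r)).exists_isMaxOn ⟨(t₂, x₂, v₂), ht₂, hz₂⟩ hcont
  simp only at ht₁
  have h2 : H t₂ x₂ v₂ - (S + δ) * |t₂ - t₀| ≤ H t₁ x₁ v₁ - (S + δ) * |t₁ - t₀| :=
    hmax (show (t₂, x₂, v₂) ∈ _ from ⟨ht₂, hz₂⟩)
  have h3 : m < H t₁ x₁ v₁ - (S + δ) * |t₁ - t₀| := by
    have := mul_le_mul_of_nonneg_left hdist (show 0 ≤ S + δ by linarith)
    nlinarith
  -- The maximum over the compact set is global: outside the ball `H` vanishes, and the maximal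
  -- value is positive.
  have hall : ∀ t ∈ Icc 0 T, ∀ x v, H t x v - (S + δ) * |t - t₀| ≤
      H t₁ x₁ v₁ - (S + δ) * |t₁ - t₀| := by
    intro t ht x v
    by_cases hz : ((x, v) : E3 × E3) ∈ Metric.closedBall (0 : E3 × E3) r
    · exact hmax (show (t, x, v) ∈ _ from ⟨ht, hz⟩)
    · have := (hs t ht).eq_zero (x, v) (not_le.1 fun h => hz (mem_closedBall_zero_iff.2 h))
      simp only at this
      have := mul_nonneg (show 0 ≤ S + δ by linarith) (abs_nonneg (t - t₀))
      linarith
  have hne : t₁ ≠ t₀ := by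
    rintro rfl
    have := h0 x₁ v₁
    simp at h3
    linarith
  have hx : dx H t₁ x₁ v₁ = 0 := by
    have : IsLocalMax (fun y => H t₁ y v₁) x₁ := .of_forall fun y => by
      have := hall t₁ ht₁ y v₁
      linarith
    rw [dx, gradient, this.fderiv_eq_zero, map_zero]
  have hv : dv H t₁ x₁ v₁ = 0 := by
    have : IsLocalMax (fun w => H t₁ x₁ w) v₁ := .of_forall fun y => by
      have := hall t₁ ht₁ x₁ y
      linarith
    rw [dv, gradient, this.fderiv_eq_zero, map_zero]
  have := le_abs_of_isMaxOn_sub_mul_abs ht₁ ht₀ hne (hH.hasDerivWithinAt ht₁ x₁ v₁)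
    fun s hs => hall s hs x₁ v₁
  linarith [hcrit t₁ ht₁ x₁ v₁ hx hv]

lemma IsC1.sub {T : ℝ} {h h' : ℝ → E3 → E3 → ℝ} (hh : IsC1 T h) (hh' : IsC1 T h') :
    IsC1 T fun t x v => h t x v - h' t x v :=
  ContDiffOn.sub hh hh'

/-! ### Stability of the transport equations -/

section Transport

variable {T r M P D ρ m t₀ : ℝ} {f f' h h' : ℝ → E3 → E3 → ℝ} {B B' : ℝ → E3 → E3}
  {R R' : ℝ → E3 → E3 → ℝ}

/-- At a critical point of `h - h'` both functions have the same gradients, so subtracting the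
equations leaves only field and source differences. No derivative bound for the fields enters. -/
lemma sub_le_of_vlasovOp_eq (hT : 0 < T) (hr : 0 ≤ r) (ht₀ : t₀ ∈ Icc 0 T)
    (hh : IsC1 T h) (hh' : IsC1 T h') (hs : ∀ t ∈ Icc 0 T, IsC1Supported r (h t))
    (hs' : ∀ t ∈ Icc 0 T, IsC1Supported r (h' t))
    (hop : ∀ t ∈ Icc 0 T, ∀ x v, vlasovOp T f B h t x v = R t x v)
    (hop' : ∀ t ∈ Icc 0 T, ∀ x v, vlasovOp T f' B' h' t x v = R' t x v)
    (hM : ∀ t ∈ Icc 0 T, ∀ x v, ‖dv h' t x v‖ ≤ M)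
    (hP : ∀ t ∈ Icc 0 T, ∀ x, ‖gradient (psi f t) x - gradient (psi f' t) x‖ ≤ P)
    (hD : ∀ t ∈ Icc 0 T, ∀ x, ‖B t x - B' t x‖ ≤ D)
    (hR : ∀ t ∈ Icc 0 T, ∀ x v, |R t x v - R' t x v| ≤ ρ)
    (hm : 0 ≤ m) (h0 : ∀ x v, h t₀ x v - h' t₀ x v ≤ m) :
    ∀ t ∈ Icc 0 T, ∀ x v, h t x v - h' t x v ≤ m + (P * M + r * D * M + ρ) * T := by
  have hM0 : 0 ≤ M := (norm_nonneg _).trans (hM t₀ ht₀ 0 0)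
  have hP0 : 0 ≤ P := (norm_nonneg _).trans (hP t₀ ht₀ 0)
  have hD0 : 0 ≤ D := (norm_nonneg _).trans (hD t₀ ht₀ 0)
  have hρ0 : 0 ≤ ρ := (abs_nonneg _).trans (hR t₀ ht₀ 0 0)
  refine le_add_of_abs_dt_le hT ht₀ (hh.sub hh') (fun t ht => (hs t ht).sub (hs' t ht))
    (by positivity) hm h0 fun t ht x v hx hv => ?_
  have ex : dx h t x v = dx h' t x v := by
    rw [← sub_eq_zero, ← hx]
    exact (gradient_sub ((hs t ht).differentiableAt_left x v)
      ((hs' t ht).differentiableAt_left x v)).symm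
  have ev : dv h t x v = dv h' t x v := by
    rw [← sub_eq_zero, ← hv]
    exact (gradient_sub ((hs t ht).differentiableAt_right x v)
      ((hs' t ht).differentiableAt_right x v)).symm
  have et : dt T (fun t x v => h t x v - h' t x v) t x v = dt T h t x v - dt T h' t x v :=
    derivWithin_fun_sub (hh.hasDerivWithinAt ht x v).differentiableWithinAt
      (hh'.hasDerivWithinAt ht x v).differentiableWithinAt
  have e1 := hop t ht x v
  have e2 := hop' t ht x v
  unfold vlasovOp at e1 e2
  rw [ex, ev] at e1
  have e : dt T h t x v - dt T h' t x v =
      inner ℝ (gradient (psi f t) x - gradient (psi f' t) x) (dv h' t x v)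
      - inner ℝ (cross v (B t x - B' t x)) (dv h' t x v) + (R t x v - R' t x v) := by
    rw [(isLinearMap_cross v).map_sub, inner_sub_left, inner_sub_left]
    linarith
  have b1 : |inner ℝ (gradient (psi f t) x - gradient (psi f' t) x) (dv h' t x v)| ≤ P * M :=
    (abs_real_inner_le_norm _ _).trans
      (mul_le_mul (hP t ht x) (hM t ht x v) (norm_nonneg _) hP0)
  have b2 : |inner ℝ (cross v (B t x - B' t x)) (dv h' t x v)| ≤ r * D * M := by
    -- The unbounded factor `v` is harmless because `∂ᵥh'` vanishes for `|v| > r`.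
    rcases lt_or_ge r ‖v‖ with hrv | hrv
    · have : dv h' t x v = 0 :=
        (hs' t ht).gradv_eq_zero (z := (x, v)) (hrv.trans_le (norm_snd_le (x, v)))
      rw [this, inner_zero_right, abs_zero]
      positivity
    · refine (abs_real_inner_le_norm _ _).trans
        (mul_le_mul ((norm_cross_le _ _).trans ?_) (hM t ht x v) (norm_nonneg _) (by positivity))
      exact mul_le_mul hrv (hD t ht x) (norm_nonneg _) hr
  rw [et, e]
  refine (abs_add_le _ _).trans (add_le_add ((abs_sub _ _).trans (add_le_add b1 b2)) (hR t ht x v))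

lemma abs_sub_le_of_vlasovOp_eq (hT : 0 < T) (hr : 0 ≤ r) (ht₀ : t₀ ∈ Icc 0 T)
    (hh : IsC1 T h) (hh' : IsC1 T h') (hs : ∀ t ∈ Icc 0 T, IsC1Supported r (h t))
    (hs' : ∀ t ∈ Icc 0 T, IsC1Supported r (h' t))
    (hop : ∀ t ∈ Icc 0 T, ∀ x v, vlasovOp T f B h t x v = R t x v)
    (hop' : ∀ t ∈ Icc 0 T, ∀ x v, vlasovOp T f' B' h' t x v = R' t x v)
    (hM : ∀ t ∈ Icc 0 T, ∀ x v, ‖dv h t x v‖ ≤ M)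
    (hM' : ∀ t ∈ Icc 0 T, ∀ x v, ‖dv h' t x v‖ ≤ M)
    (hP : ∀ t ∈ Icc 0 T, ∀ x, ‖gradient (psi f t) x - gradient (psi f' t) x‖ ≤ P)
    (hD : ∀ t ∈ Icc 0 T, ∀ x, ‖B t x - B' t x‖ ≤ D)
    (hR : ∀ t ∈ Icc 0 T, ∀ x v, |R t x v - R' t x v| ≤ ρ)
    (hm : 0 ≤ m) (h0 : ∀ x v, |h t₀ x v - h' t₀ x v| ≤ m) :
    ∀ t ∈ Icc 0 T, ∀ x v, |h t x v - h' t x v| ≤ m + (P * M + r * D * M + ρ) * T := by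
  intro t ht x v
  refine abs_sub_le_iff.2 ⟨?_, ?_⟩
  · exact sub_le_of_vlasovOp_eq hT hr ht₀ hh hh' hs hs' hop hop' hM' hP hD hR hm
      (fun x v => (abs_sub_le_iff.1 (h0 x v)).1) t ht x v
  · exact sub_le_of_vlasovOp_eq hT hr ht₀ hh' hh hs' hs hop' hop hM
      (fun t ht x => by rw [norm_sub_rev]; exact hP t ht x)
      (fun t ht x => by rw [norm_sub_rev]; exact hD t ht x)
      (fun t ht x v => by rw [abs_sub_comm]; exact hR t ht x v) hm
      (fun x v => (abs_sub_le_iff.1 (h0 x v)).2) t ht x v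

end Transport

/-! ### Contraction and conclusion -/

/-- The Lipschitz constant (up to the factor `1 / λ`) of the right-hand sides of the system. -/
def sourceConst (r M : ℝ) : ℝ := (4 * M + 2 * r ^ 2 * M ^ 2) * kernelConst r

section Contraction

variable {T lam r M α : ℝ} {f₀ fd χ : E3 → E3 → ℝ} {f g f' g' : ℝ → E3 → E3 → ℝ}
  {B B' : ℝ → E3 → E3}

/-- The first `α / 4` is the growth of `f - f'` from zero initial data. It is also the bound on the
terminal data of `g - g'`, since `fd` cancels, and the backward growth adds another `α / 4`. -/
lemma abs_sub_le_half (hT : 0 < T) (hlam : 0 < lam) (hlam1 : lam ≤ 1) (hr : 0 ≤ r) (hM : 0 ≤ M)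
    (hsmall : sourceConst r M * (T / lam) ≤ 1 / 4) (hχ : IsC2Weight χ)
    (hS : IsClassicalSolution T lam f₀ fd χ r f g B)
    (hS' : IsClassicalSolution T lam f₀ fd χ r f' g' B')
    (hf : C1BoundedBy T M f) (hg : C1BoundedBy T M g) (hf' : C1BoundedBy T M f')
    (hg' : C1BoundedBy T M g') (hα : 0 ≤ α)
    (hfα : ∀ t ∈ Icc 0 T, ∀ x v, |f t x v - f' t x v| ≤ α)
    (hgα : ∀ t ∈ Icc 0 T, ∀ x v, |g t x v - g' t x v| ≤ α) :
    (∀ t ∈ Icc 0 T, ∀ x v, |f t x v - f' t x v| ≤ α / 2) ∧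
      ∀ t ∈ Icc 0 T, ∀ x v, |g t x v - g' t x v| ≤ α / 2 := by
  have sf := fun t (ht : t ∈ Icc 0 T) => hS.f_C1.isC1Supported hS.f_supp ht
  have sg := fun t (ht : t ∈ Icc 0 T) => hS.g_C1.isC1Supported hS.g_supp ht
  have sf' := fun t (ht : t ∈ Icc 0 T) => hS'.f_C1.isC1Supported hS'.f_supp ht
  have sg' := fun t (ht : t ∈ Icc 0 T) => hS'.g_C1.isC1Supported hS'.g_supp ht
  have bf := fun t ht x v => (hf t ht x v).2.2
  have bg := fun t ht x v => (hg t ht x v).2.2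
  have bf' := fun t ht x v => (hf' t ht x v).2.2
  have bg' := fun t ht x v => (hg' t ht x v).2.2
  have hK := kernelConst_nonneg r
  set K := kernelConst r
  have hP : ∀ t ∈ Icc 0 T, ∀ x, ‖gradient (psi f t) x - gradient (psi f' t) x‖ ≤ 2 * α * K :=
    fun t ht x => norm_gradient_psi_sub_le (sf t ht) (sf' t ht) hα (hfα t ht) x
  have hD : ∀ t ∈ Icc 0 T, ∀ x, ‖B t x - B' t x‖ ≤ 1 / lam * (2 * r * M * α * K) := by
    intro t ht x
    rw [hS.B_eq t ht x, hS'.B_eq t ht x, ← smul_sub, norm_smul, norm_neg,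
      Real.norm_of_nonneg (by positivity)]
    refine mul_le_mul ?_ (norm_integral_biotSavart_sub_le hr (sf t ht) (sg t ht) (sf' t ht)
      (sg' t ht) hα (hfα t ht) (hgα t ht) (bf t ht) (bg' t ht) x) (norm_nonneg _) (by positivity)
    refine one_div_le_one_div_of_le hlam ?_
    nlinarith [Real.pi_gt_three]
  have hΦ : ∀ t ∈ Icc 0 T, ∀ x v,
      |Phi f g t x * χ x v - Phi f' g' t x * χ x v| ≤ 2 * M * α * K := by
    intro t ht x v
    rw [← sub_mul, abs_mul, abs_of_nonneg (hχ.2 x v).1]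
    exact (mul_le_of_le_one_right (abs_nonneg _) (hχ.2 x v).2).trans
      (abs_Phi_sub_le (sf t ht) (sg t ht) (sf' t ht) (sg' t ht) hα (hfα t ht) (hgα t ht)
        (bf t ht) (bg' t ht) x)
  have hone : 1 ≤ 1 / lam := by rwa [le_div_iff₀ hlam, one_mul]
  -- Both equations are covered: `ρ = 0` for `f`, the bound on the `Φ` difference for `g`. Terms
  -- without `1 / λ` are absorbed using `λ ≤ 1`.
  have hρ : ∀ ρ, ρ ≤ 2 * M * α * K →
      (2 * α * K * M + r * (1 / lam * (2 * r * M * α * K)) * M + ρ) * T ≤ α / 4 := by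
    intro ρ hρ
    have h1 : 4 * M * α * K ≤ 1 / lam * (4 * M * α * K) :=
      le_mul_of_one_le_left (by positivity) hone
    have h2 : 2 * α * K * M + r * (1 / lam * (2 * r * M * α * K)) * M + ρ ≤
        α * (sourceConst r M * (1 / lam)) := by
      calc _ ≤ 4 * M * α * K + r * (1 / lam * (2 * r * M * α * K)) * M := by linarith
        _ ≤ 1 / lam * (4 * M * α * K) + r * (1 / lam * (2 * r * M * α * K)) * M := by linarith
        _ = _ := by unfold sourceConst; ring
    calc _ ≤ α * (sourceConst r M * (1 / lam)) * T := mul_le_mul_of_nonneg_right h2 hT.le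
      _ = α * (sourceConst r M * (T / lam)) := by ring
      _ ≤ α * (1 / 4) := mul_le_mul_of_nonneg_left hsmall hα
      _ = α / 4 := by ring
  have F : ∀ t ∈ Icc 0 T, ∀ x v, |f t x v - f' t x v| ≤ α / 4 := by
    intro t ht x v
    have := abs_sub_le_of_vlasovOp_eq (R := fun _ _ _ => 0) (R' := fun _ _ _ => 0) (ρ := 0) (m := 0)
      hT hr (left_mem_Icc.2 hT.le) hS.f_C1
      hS'.f_C1 sf sf' hS.f_eq hS'.f_eq bf bf' hP hD (by simp) le_rfl
      (by simp [hS.f_init, hS'.f_init]) t ht x v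
    linarith [hρ 0 (by positivity)]
  refine ⟨fun t ht x v => (F t ht x v).trans (by linarith), fun t ht x v => ?_⟩
  have hTm : T ∈ Icc 0 T := right_mem_Icc.2 hT.le
  have := abs_sub_le_of_vlasovOp_eq (R := fun t x v => Phi f g t x * χ x v)
    (R' := fun t x v => Phi f' g' t x * χ x v) (m := α / 4)
    hT hr hTm hS.g_C1 hS'.g_C1 sg sg' hS.g_eq hS'.g_eq bg bg' hP hD hΦ (by positivity)
    (fun x v => by
      rw [hS.g_final, hS'.g_final, sub_sub_sub_cancel_right]
      exact F T hTm x v) t ht x v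
  linarith [hρ _ le_rfl]

end Contraction

end VlasovPoisson

end

theorem mainTheorem9 (f₀ fd : VlasovPoisson.E3 → VlasovPoisson.E3 → ℝ)
    (hf₀ : VlasovPoisson.IsC2c f₀) (hfd : VlasovPoisson.IsC2c fd)
    (r M : ℝ) (hr : 0 < r) :
    ∃ ε > 0, ∀ (T lam : ℝ), 0 < T → 0 < lam → lam ≤ 1 → T / lam < ε →
      ∀ χ : VlasovPoisson.E3 → VlasovPoisson.E3 → ℝ, VlasovPoisson.IsC2Weight χ →
      ∀ (f g f' g' : ℝ → VlasovPoisson.E3 → VlasovPoisson.E3 → ℝ)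
        (B B' : ℝ → VlasovPoisson.E3 → VlasovPoisson.E3),
        VlasovPoisson.IsClassicalSolution T lam f₀ fd χ r f g B →
        VlasovPoisson.IsClassicalSolution T lam f₀ fd χ r f' g' B' →
        VlasovPoisson.C1BoundedBy T M f → VlasovPoisson.C1BoundedBy T M g →
        VlasovPoisson.C1BoundedBy T M f' → VlasovPoisson.C1BoundedBy T M g' →
        ∀ t ∈ Set.Icc 0 T,
          (∀ x v, f t x v = f' t x v) ∧ (∀ x v, g t x v = g' t x v) ∧ (∀ x, B t x = B' t x) := by
  -- The absolute value and the `+ 1` keep the witness positive for every real `M`; that `M ≥ 0`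
  -- follows only once a solution is given.
  refine ⟨1 / (4 * (|VlasovPoisson.sourceConst r M| + 1)), by positivity, ?_⟩
  intro T lam hT hlam hlam1 hε χ hχ f g f' g' B B' hS hS' hf hg hf' hg'
  have hM : 0 ≤ M := (abs_nonneg _).trans (hf 0 (left_mem_Icc.2 hT.le) 0 0).1
  have hq : 0 ≤ T / lam := by positivity
  have hsmall : VlasovPoisson.sourceConst r M * (T / lam) ≤ 1 / 4 := by
    rw [lt_div_iff₀ (by positivity)] at hε
    have := mul_le_mul_of_nonneg_right (le_abs_self (VlasovPoisson.sourceConst r M)) hq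
    linarith
  have hn : ∀ n : ℕ, (∀ t ∈ Icc 0 T, ∀ x v, |f t x v - f' t x v| ≤ 2 * M * (1 / 2) ^ n) ∧
      ∀ t ∈ Icc 0 T, ∀ x v, |g t x v - g' t x v| ≤ 2 * M * (1 / 2) ^ n := by
    intro n
    induction n with
    | zero =>
      refine ⟨fun t ht x v => ?_, fun t ht x v => ?_⟩
      · have := abs_sub (f t x v) (f' t x v)
        linarith [(hf t ht x v).1, (hf' t ht x v).1]
      · have := abs_sub (g t x v) (g' t x v)
        linarith [(hg t ht x v).1, (hg' t ht x v).1]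
    | succ n ih =>
      have := VlasovPoisson.abs_sub_le_half hT hlam hlam1 hr.le hM hsmall hχ hS hS' hf hg hf' hg'
        (by positivity) ih.1 ih.2
      rw [pow_succ, ← mul_assoc, mul_one_div]
      exact this
  have hlim : Filter.Tendsto (fun n : ℕ => 2 * M * (1 / 2 : ℝ) ^ n) Filter.atTop (nhds 0) := by
    simpa using (tendsto_pow_atTop_nhds_zero_of_lt_one (r := (1 / 2 : ℝ)) (by norm_num)
      (by norm_num)).const_mul (2 * M)
  have zero : ∀ a b : ℝ, (∀ n : ℕ, |a - b| ≤ 2 * M * (1 / 2) ^ n) → a = b := fun a b hab =>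
    sub_eq_zero.1 (abs_nonpos_iff.1 (ge_of_tendsto' hlim hab))
  intro t ht
  have ef : ∀ x v, f t x v = f' t x v := fun x v => zero _ _ fun n => (hn n).1 t ht x v
  have eg : ∀ x v, g t x v = g' t x v := fun x v => zero _ _ fun n => (hn n).2 t ht x v
  refine ⟨ef, eg, fun x => ?_⟩
  rw [hS.B_eq t ht x, hS'.B_eq t ht x]
  simp only [VlasovPoisson.dv, ef, eg]
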